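/- Let $q>0$. Each up-pointing triangle of the triangular lattice carries one of five configurations: empty, exactly one of its three sides occupied, or full (all three sides occupied), with weights $e\ge 0$, $s\ge 0$ (for each of the three sides) and $a>0$, respectively. For a finite non-empty set $\Lambda$ of up-pointing triangles and a wiring $\Gamma$ (a partition of the set of corners of triangles in $\Lambda$ into classes of sites considered to be preconnected), the random cluster measure gives a configuration $\omega$ a probability proportional to $$q^{c(\omega,\Gamma)}\,e^{|\mathsf e(\omega)|}\,s^{|\mathsf s(\omega)|}\,a^{|\mathsf a(\omega)|},$$ where $|\mathsf e(\omega)|,|\mathsf s(\omega)|,|\mathsf a(\omega)|$ are the numbers of empty, singly occupied and full triangles and $c(\omega,\Gamma)$ is the number of connected components of the sites of $\Lambda$. Free boundary conditions mean no wiring. Wired boundary conditions mean that two sites are wired together iff they are joined by a path of bonds of triangles outside $\Lambda$. The dual triangular lattice has as sites the centres of the down-pointing faces, and as interaction triangles the down-pointing triangles formed by the three faces adjacent to an up-pointing triangle. Given $\omega$, let $\omega^\bigstar$ be its planar dual on the honeycomb lattice (a honeycomb bond is occupied iff the bond that it crosses is vacant), and let $\omega^*$ be obtained by integrating out the centres of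 the up-pointing triangles: on each down-pointing triangle, $\omega^*$ is the one of the five configurations that records which of the three outer vertices of the triad are connected through its centre. Theorem. Let $\Lambda$ be a finite non-empty set of up-pointing triangles. 1. The map $\omega\mapsto\omega^*$ is a bijection of configurations, and for every wiring of the dual sites, two dual sites are connected in $\omega^*$ iff they are connected in $\omega^\bigstar$. 2. Let $e^*,s^*,a^*\ge 0$. The map $\omega\mapsto\omega^*$ carries the random cluster measure on $\Lambda$ with weights $(e,s,a)$ and free boundary conditions to the random cluster measure on the corresponding down-pointing triangles of the dual lattice with weights $(e^*,s^*,a^*)$, the same $q$ and wired boundary conditions if and only if $$e^*>0,\qquad \frac{s^*}{e^*}=\frac{qs}{a},\qquad \frac{a^*}{e^*}=\frac{q^2e}{a}.$$ The same equivalence holds with wired boundary conditions for the original measure and free ones for the dual measure. 3. If $\Lambda$ has no holes (any two up-pointing triangles outside $\Lambda$ are joined by a chain of such triangles in which consecutive ones share a corner), then wired boundary conditions, for either lattice, are the fully wired ones: all sites that are also corners of a triangle outside $\Lambda$ are wired together. 4. There is exactly one triple $(e^*,s^*,a^*)$ of non-negative numbers with $a^*+3s^*+e^*=1$ that satisfies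 the relations in 2. The triple $(e,s,a)$ satisfies these relations with $(e^*,s^*,a^*)=(e,s,a)$ if and only if $a=qe$; in particular, if $a+3s+e=1$, then the normalized dual triple equals $(e,s,a)$ if and only if $a=qe$. -/

import Mathlib

/-- The offsets `(0,0)`, `(1,0)`, `(0,1)` of the corners of a lattice triangle, in a lattice basis
of the triangular lattice (two unit vectors at angle `π / 3`). -/
def offset : Fin 3 → ℤ × ℤ := ![(0, 0), (1, 0), (0, 1)]

/-- The two mutually dual triangular lattices: `up` is the original lattice, whose interaction
triangles are the up-pointing ones; `down` is the lattice whose sites are the centres of the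
down-pointing triangles of the original one, and whose interaction triangles are down-pointing,
one around the centre of each up-pointing triangle of the original lattice. -/
inductive TriLattice
  | up
  | down

/-- The `k`-th corner of the triangle labelled `t`. Labels `t` of triangles are shared by the two
lattices: the down-pointing triangle `t` of the dual lattice surrounds the centre of the
up-pointing triangle `t`. The site `d` of the dual lattice is the centre of the down-pointing face
`d` (see `faceCorner`), and the `k`-th corner of the dual triangle `t` is the face across the side
of the up-pointing triangle `t` that is opposite to its `k`-th corner. -/
def corner : TriLattice → ℤ × ℤ → Fin 3 → ℤ × ℤ
  | .up, t, k => t + offset k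
  | .down, t, k => t - offset k

/-- The corners `d + (1,1)`, `d + (0,1)`, `d + (1,0)` of the down-pointing face `d` of the original
triangular lattice. -/
def faceCorner (d : ℤ × ℤ) (m : Fin 3) : ℤ × ℤ := d + (1, 1) - offset m

/-- The side of the up-pointing triangle `t` opposite to corner `k` is also a side of the
down-pointing face `corner .down t k`. -/
theorem corner_up_mem_face (t : ℤ × ℤ) (k j : Fin 3) (h : j ≠ k) :
    ∃ m, corner .up t j = faceCorner (corner .down t k) m := by
  obtain ⟨x, y⟩ := t
  refine ⟨-(k + j), ?_⟩
  fin_cases k <;> fin_cases j <;> simp [corner, faceCorner, offset] at h ⊢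

/-- The point reflection `x ↦ -x` carries the dual lattice, with its triangles, to the original
one. -/
theorem corner_up_neg (t : ℤ × ℤ) (k : Fin 3) : corner .up (-t) k = -corner .down t k := by
  simp only [corner]; abel

/-- The five configurations of a triangle: empty, only the side opposite to corner `k`
occupied, full. -/
inductive TriState
  | E
  | S (k : Fin 3)
  | A
  deriving DecidableEq, Fintype

/-- The set of occupied sides; side `k` is opposite to corner `k`. -/
def TriState.occupied : TriState → Finset (Fin 3)
  | .E => ∅
  | .S k => {k}
  | .A => Finset.univ

/-- A configuration on the finite collection `Λ` of triangles. -/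
abbrev Config (Λ : Finset (ℤ × ℤ)) := Λ → TriState

/-- The sites of a finite collection of triangles: all their corners. -/
abbrev Site (L : TriLattice) (Λ : Finset (ℤ × ℤ)) := {x : ℤ × ℤ // ∃ t ∈ Λ, ∃ k, corner L t k = x}

/-- `x` and `y` are end points of an occupied bond (or `x = y` is one). -/
def Bond (L : TriLattice) {Λ : Finset (ℤ × ℤ)} (ω : Config Λ) (x y : Site L Λ) : Prop :=
  ∃ t : Λ, ∃ k ∈ (ω t).occupied, ∃ i j : Fin 3, i ≠ k ∧ j ≠ k ∧
    corner L t i = x ∧ corner L t j = y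

/-- The partition of the sites into clusters, when the classes of the wiring `Γ` are considered to
be preconnected. -/
def clusters (L : TriLattice) {Λ : Finset (ℤ × ℤ)} (Γ : Setoid (Site L Λ)) (ω : Config Λ) :
    Setoid (Site L Λ) :=
  Relation.EqvGen.setoid fun x y => Γ x y ∨ Bond L ω x y

/-- The number `c(ω, Γ)` of clusters. -/
noncomputable def numClusters (L : TriLattice) {Λ : Finset (ℤ × ℤ)} (Γ : Setoid (Site L Λ))
    (ω : Config Λ) : ℕ :=
  Nat.card (Quotient (clusters L Γ ω))

/-- The weights of an empty triangle, of each of the three singly occupied ones, and of a full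
one. -/
@[ext]
structure Weights where
  e : ℝ
  s : ℝ
  a : ℝ
  e_nonneg : 0 ≤ e
  s_nonneg : 0 ≤ s
  a_nonneg : 0 ≤ a

/-- The weight of the configuration of one triangle. -/
def Weights.of (w : Weights) : TriState → ℝ
  | .E => w.e
  | .S _ => w.s
  | .A => w.a

/-- The normalization `a + 3 s + e = 1`. -/
def Weights.Normalized (w : Weights) : Prop := w.a + 3 * w.s + w.e = 1

/-- The random cluster weight `q ^ c(ω, Γ) * e ^ |e(ω)| * s ^ |s(ω)| * a ^ |a(ω)|`. -/
noncomputable def rcWeight (q : ℝ) (w : Weights) (L : TriLattice) {Λ : Finset (ℤ × ℤ)}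
    (Γ : Setoid (Site L Λ)) (ω : Config Λ) : ℝ :=
  q ^ numClusters L Γ ω * ∏ t, w.of (ω t)

/-- The probability of `ω` under the random cluster measure with wiring `Γ`. -/
noncomputable def rcProb (q : ℝ) (w : Weights) (L : TriLattice) {Λ : Finset (ℤ × ℤ)}
    (Γ : Setoid (Site L Λ)) (ω : Config Λ) : ℝ :=
  rcWeight q w L Γ ω / ∑ ω' : Config Λ, rcWeight q w L Γ ω'

/-- Free boundary conditions: no wiring. -/
def free (L : TriLattice) (Λ : Finset (ℤ × ℤ)) : Setoid (Site L Λ) := ⊥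

/-- `x` is a boundary site: it is also a corner of a triangle outside `Λ`. -/
def IsBoundary (L : TriLattice) (Λ : Finset (ℤ × ℤ)) (x : ℤ × ℤ) : Prop :=
  ∃ t ∉ Λ, ∃ k, corner L t k = x

/-- All boundary sites are wired together. -/
def fullyWired (L : TriLattice) (Λ : Finset (ℤ × ℤ)) : Setoid (Site L Λ) where
  r x y := x = y ∨ (IsBoundary L Λ x ∧ IsBoundary L Λ y)
  iseqv := by
    refine ⟨fun _ => Or.inl rfl, ?_, ?_⟩
    · rintro x y (h | ⟨h, h'⟩)
      · exact Or.inl h.symm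
      · exact Or.inr ⟨h', h⟩
    · rintro x y z (h | ⟨h, h'⟩) (k | ⟨k, k'⟩)
      · exact Or.inl (h.trans k)
      · subst h; exact Or.inr ⟨k, k'⟩
      · subst k; exact Or.inr ⟨h, h'⟩
      · exact Or.inr ⟨h, k'⟩

/-- Wired boundary conditions for a region that may have holes: all triangles outside `Λ` are full,
so that two sites are wired together if they are joined by a path of bonds of such triangles. -/
def wired (L : TriLattice) (Λ : Finset (ℤ × ℤ)) : Setoid (Site L Λ) :=
  Setoid.comap Subtype.val
    (Relation.EqvGen.setoid fun x y : ℤ × ℤ => ∃ t ∉ Λ, ∃ i j, corner L t i = x ∧ corner L t j = y)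

/-- `Λ` has no holes: any two up-pointing triangles outside `Λ` are joined by a chain of such
triangles in which consecutive ones share a corner. -/
def HoleFree (Λ : Finset (ℤ × ℤ)) : Prop :=
  ∀ t ∉ Λ, ∀ t' ∉ Λ,
    Relation.ReflTransGen (fun u v => v ∉ Λ ∧ ∃ i j, corner .up u i = corner .up v j) t t'

/-- A bond configuration on the honeycomb lattice, restricted to the triads at the centres of the
triangles in `Λ`: the bond `k` at `t` joins the centre of the up-pointing triangle `t` to the centre
of the down-pointing face `corner .down t k` and crosses the side `k` of `t`. -/
abbrev HoneycombConfig (Λ : Finset (ℤ × ℤ)) := Λ → Finset (Fin 3)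

/-- The standard planar dual: a honeycomb bond is occupied iff the bond it crosses is vacant. -/
def starDual {Λ : Finset (ℤ × ℤ)} (ω : Config Λ) : HoneycombConfig Λ := fun t => (ω t).occupiedᶜ

/-- The clusters of a honeycomb configuration, on centres `t ∈ Λ` and faces (sites of the dual
lattice), with a wiring `Γ` of the latter. -/
def honeycombClusters {Λ : Finset (ℤ × ℤ)} (Γ : Setoid (Site .down Λ)) (η : HoneycombConfig Λ) :
    Setoid (Λ ⊕ Site .down Λ) :=
  Relation.EqvGen.setoid fun u v =>
    (∃ x y, Γ x y ∧ u = .inr x ∧ v = .inr y) ∨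
    ∃ t : Λ, ∃ k ∈ η t, ∃ x : Site .down Λ, corner .down t k = x ∧ u = .inl t ∧ v = .inr x

/-- Integrating out the centre of a triad: what is kept is which of its three outer vertices are
joined through the centre. -/
def integrateTriad (b : Finset (Fin 3)) : TriState :=
  if b = Finset.univ then .A
  else if b = {0}ᶜ then .S 0
  else if b = {1}ᶜ then .S 1
  else if b = {2}ᶜ then .S 2
  else .E

/-- The dual configuration `ω*` on the dual triangular lattice. -/
def dualConfig {Λ : Finset (ℤ × ℤ)} (ω : Config Λ) : Config Λ :=
  fun t => integrateTriad (starDual ω t)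

/-- The duality relations `s* / e* = q s / a` and `a* / e* = q² e / a` between the weights `w` and
the weights `w'` of the dual model. -/
def DualityRelations (q : ℝ) (w w' : Weights) : Prop :=
  0 < w'.e ∧ w'.s / w'.e = q * w.s / w.a ∧ w'.a / w'.e = q ^ 2 * w.e / w.a

/-! The measures correspond because of Euler's formula (`exists_numClusters_free_add`): the free
cluster number of ω minus the wired cluster number of ω* minus the sum of the deficits (2, 1, 0 for
an empty, singly occupied, full triangle) does not depend on ω. So passing to ω* costs, up to a
constant, a factor of q to the deficit for each triangle, and the duality relations say that the
local weights supply exactly this factor (`Weights.of_dual`). Constants cancel in the normalization,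
so Euler's formula is needed only up to an additive constant. Conversely, a configuration that is
empty off one triangle detects each dual weight separately.

Euler's formula follows by changing one triangle t at a time. The change in the cluster numbers
depends only on which corners of t, and which faces at t, are connected off t. Planarity enters
through one alternative: the end points of side k are connected off t if and only if the face across
side k is connected off t to neither of the other two faces. Both halves are `ZMod 2` homology in
place of the Jordan curve theorem. In `not_clusters_flip_of_clusters`, a path closed up by side k
bounds a set of cells, whose indicator separates the faces. In `clusters_flip_of_not_clusters`, the
coboundary of a cluster, paired with the indicator of a dual cluster, would be 0 globally but 1 when
summed triangle by triangle. -/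

/-! ### Merging two classes of an equivalence relation. -/

/-- The setoid obtained from `r` by merging the classes of `a` and `b`. -/
def Setoid.merge {α : Type*} (r : Setoid α) (a b : α) : Setoid α where
  r x y := r x y ∨ ((r x a ∨ r x b) ∧ (r y a ∨ r y b))
  iseqv := by
    refine ⟨fun x => Or.inl (r.refl x), ?_, ?_⟩
    · rintro x y (h | ⟨h, h'⟩)
      · exact Or.inl (r.symm h)
      · exact Or.inr ⟨h', h⟩
    · rintro x y z (h | ⟨h, h'⟩) (k | ⟨k, k'⟩)
      · exact Or.inl (r.trans h k)
      · exact Or.inr ⟨k.imp (r.trans h) (r.trans h), k'⟩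
      · exact Or.inr ⟨h, h'.imp (r.trans (r.symm k)) (r.trans (r.symm k))⟩
      · exact Or.inr ⟨h, k'⟩

theorem Setoid.merge_apply {α : Type*} (r : Setoid α) (a b x y : α) :
    r.merge a b x y ↔ r x y ∨ ((r x a ∨ r x b) ∧ (r y a ∨ r y b)) := Iff.rfl

/-- Universal property; with `clusters_le_iff` it identifies cluster partitions by their upper
bounds, without analysing paths. -/
theorem Setoid.merge_le_iff {α : Type*} (r : Setoid α) (a b : α) (s : Setoid α) :
    r.merge a b ≤ s ↔ r ≤ s ∧ s a b := by
  constructor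
  · intro h
    exact ⟨fun x y hxy => h (Or.inl hxy), h (Or.inr ⟨Or.inl (r.refl a), Or.inr (r.refl b)⟩)⟩
  · rintro ⟨h, hab⟩ x y (hxy | ⟨hx, hy⟩)
    · exact h hxy
    · have key : ∀ z, r z a ∨ r z b → s z a := fun z hz =>
        hz.elim (fun hz => h hz) fun hz => s.trans (h hz) (s.symm hab)
      exact s.trans (key x hx) (s.symm (key y hy))

open Classical in
theorem Setoid.card_quotient_merge {α : Type*} [Finite α] (r : Setoid α) (a b : α) :
    Nat.card (Quotient r) = Nat.card (Quotient (r.merge a b)) + if r a b then 0 else 1 := by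
  split_ifs with hab
  · have : r.merge a b = r :=
      le_antisymm ((r.merge_le_iff a b r).2 ⟨le_rfl, hab⟩) fun x y h => Or.inl h
    rw [this, add_zero]
  -- The class of `b` is absorbed by that of `a`, so the remaining classes represent each merged
  -- class exactly once.
  · let f : {c : Quotient r // c ≠ Quotient.mk r b} → Quotient (r.merge a b) := fun c =>
      Quotient.map' (s₂ := r.merge a b) id (fun _ _ h => Or.inl h) c.1
    have hf : Function.Bijective f := by
      constructor
      · rintro ⟨x, hx⟩ ⟨y, hy⟩ hxy
        induction x using Quotient.inductionOn with | _ x =>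
        induction y using Quotient.inductionOn with | _ y =>
        have hxb : ¬ r x b := fun h => hx (Quotient.sound h)
        have hyb : ¬ r y b := fun h => hy (Quotient.sound h)
        have h : r.merge a b x y := Quotient.exact hxy
        apply Subtype.ext
        apply Quotient.sound
        rcases h with h | ⟨h, h'⟩
        · exact h
        · exact r.trans (h.resolve_right hxb) (r.symm (h'.resolve_right hyb))
      · intro y
        induction y using Quotient.inductionOn with | _ y =>
        by_cases hy : r y b
        · exact ⟨⟨Quotient.mk r a, fun h => hab (Quotient.exact h)⟩,
            Quotient.sound (Or.inr ⟨Or.inl (r.refl a), Or.inr hy⟩)⟩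
        · exact ⟨⟨Quotient.mk r y, fun h => hy (Quotient.exact h)⟩, rfl⟩
    rw [← Nat.card_congr (Equiv.ofBijective f hf), ← Finite.card_option,
      Nat.card_congr (Equiv.optionSubtypeNe (Quotient.mk r b))]

/-! ### Local form of the dual configuration. -/

/-- The dual lattice. -/
def TriLattice.flip : TriLattice → TriLattice
  | .up => .down
  | .down => .up

/-- The orientation of the triangles of a lattice. -/
def TriLattice.sign : TriLattice → ℤ
  | .up => 1
  | .down => -1

/-- The dual of the configuration of a triangle. -/
def TriState.dual : TriState → TriState
  | .E => .A
  | .S k => .S k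
  | .A => .E

theorem TriState.dual_dual (X : TriState) : X.dual.dual = X := by cases X <;> rfl

theorem dualConfig_apply {Λ : Finset (ℤ × ℤ)} (ω : Config Λ) (t : Λ) :
    dualConfig ω t = (ω t).dual := by
  have h : ∀ X : TriState, integrateTriad X.occupiedᶜ = X.dual := by decide
  exact h _

theorem dualConfig_dualConfig {Λ : Finset (ℤ × ℤ)} (ω : Config Λ) :
    dualConfig (dualConfig ω) = ω := by
  funext t
  simp only [dualConfig_apply, TriState.dual_dual]

theorem dualConfig_update {Λ : Finset (ℤ × ℤ)} (ω : Config Λ) (t : Λ) (X : TriState) :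
    dualConfig (Function.update ω t X) = Function.update (dualConfig ω) t X.dual := by
  funext s
  by_cases h : s = t
  · subst h; simp [dualConfig_apply]
  · simp [dualConfig_apply, h]

/-- A dual bond runs through the centre of the triangle between two faces, and both sides that it
crosses must be vacant. -/
theorem TriState.notMem_occupied_of_mem_dual (X : TriState) (k j : Fin 3)
    (hk : k ∈ X.dual.occupied) (hj : j ≠ k) : j ∉ X.occupied := by
  revert X k j; decide

/-! ### Clusters and their number when one triangle changes. -/

/-- The `k`-th corner of a triangle of `Λ`, as a site of `Λ`. -/
def site (L : TriLattice) {Λ : Finset (ℤ × ℤ)} (t : Λ) (k : Fin 3) : Site L Λ :=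
  ⟨corner L t k, t, t.2, k, rfl⟩

theorem finite_site (L : TriLattice) (Λ : Finset (ℤ × ℤ)) :
    {x : ℤ × ℤ | ∃ t ∈ Λ, ∃ k, corner L t k = x}.Finite := by
  refine ((Λ ×ˢ (Finset.univ : Finset (Fin 3))).image fun p => corner L p.1 p.2).finite_toSet.subset
    ?_
  rintro x ⟨t, ht, k, rfl⟩
  simp only [Finset.coe_image, Set.mem_image, Finset.mem_coe, Finset.mem_product]
  exact ⟨(t, k), ⟨ht, Finset.mem_univ k⟩, rfl⟩

instance (L : TriLattice) (Λ : Finset (ℤ × ℤ)) : Finite (Site L Λ) :=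
  (finite_site L Λ).to_subtype

theorem clusters_le_iff {L : TriLattice} {Λ : Finset (ℤ × ℤ)} {Γ : Setoid (Site L Λ)}
    {ω : Config Λ} {s : Setoid (Site L Λ)} :
    clusters L Γ ω ≤ s ↔ Γ ≤ s ∧
      ∀ t : Λ, ∀ k ∈ (ω t).occupied, ∀ i j, i ≠ k → j ≠ k → s (site L t i) (site L t j) := by
  constructor
  · intro h
    exact ⟨fun x y hxy => h (Relation.EqvGen.rel _ _ (Or.inl hxy)), fun t k hk i j hi hj =>
      h (Relation.EqvGen.rel _ _ (Or.inr ⟨t, k, hk, i, j, hi, hj, rfl, rfl⟩))⟩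
  · rintro ⟨h, h'⟩
    refine Setoid.eqvGen_le ?_
    rintro ⟨x, hx⟩ ⟨y, hy⟩ (hxy | ⟨t, k, hk, i, j, hi, hj, rfl, rfl⟩)
    · exact h hxy
    · exact h' t k hk i j hi hj

theorem clusters_of_mem_occupied {L : TriLattice} {Λ : Finset (ℤ × ℤ)} {Γ : Setoid (Site L Λ)}
    {ω : Config Λ} {t : Λ} {k i j : Fin 3} (hk : k ∈ (ω t).occupied) (hi : i ≠ k) (hj : j ≠ k) :
    clusters L Γ ω (site L t i) (site L t j) :=
  (clusters_le_iff.1 le_rfl).2 t k hk i j hi hj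

theorem clusters_of_wiring {L : TriLattice} {Λ : Finset (ℤ × ℤ)} {Γ : Setoid (Site L Λ)}
    {ω : Config Λ} {x y : Site L Λ} (h : Γ x y) : clusters L Γ ω x y :=
  (clusters_le_iff.1 le_rfl).1 h

theorem fin_three_eq_of_ne {i k : Fin 3} (h : i ≠ k) : i = k + 1 ∨ i = k + 2 := by
  revert i k; decide

theorem clusters_update_S {L : TriLattice} {Λ : Finset (ℤ × ℤ)} (Γ : Setoid (Site L Λ))
    (ω : Config Λ) (t : Λ) (k : Fin 3) :
    clusters L Γ (Function.update ω t (.S k)) =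
      (clusters L Γ (Function.update ω t .E)).merge (site L t (k + 1)) (site L t (k + 2)) := by
  refine eq_of_forall_ge_iff fun s => ?_
  rw [Setoid.merge_le_iff, clusters_le_iff, clusters_le_iff]
  constructor
  · rintro ⟨h, h'⟩
    refine ⟨⟨h, fun u m hm i j hi hj => ?_⟩, ?_⟩
    · by_cases hu : u = t
      · subst hu; simp [TriState.occupied] at hm
      · exact h' u m (by simpa [hu] using hm) i j hi hj
    · exact h' t k (by simp [TriState.occupied]) _ _ (by simp) (by simp)
  · rintro ⟨⟨h, h'⟩, hs⟩
    refine ⟨h, fun u m hm i j hi hj => ?_⟩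
    by_cases hu : u = t
    · subst hu
      obtain rfl : m = k := by simpa [TriState.occupied] using hm
      rcases fin_three_eq_of_ne hi with rfl | rfl <;> rcases fin_three_eq_of_ne hj with rfl | rfl
      · exact s.refl _
      · exact hs
      · exact s.symm hs
      · exact s.refl _
    · exact h' u m (by simpa [hu] using hm) i j hi hj

/-- Two sides already connect all three corners, so the third side of a full triangle is redundant.
-/
theorem clusters_update_A {L : TriLattice} {Λ : Finset (ℤ × ℤ)} (Γ : Setoid (Site L Λ))
    (ω : Config Λ) (t : Λ) (k : Fin 3) :
    clusters L Γ (Function.update ω t .A) =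
      (clusters L Γ (Function.update ω t (.S k))).merge (site L t k) (site L t (k + 1)) := by
  refine eq_of_forall_ge_iff fun s => ?_
  rw [Setoid.merge_le_iff, clusters_le_iff, clusters_le_iff]
  constructor
  · rintro ⟨h, h'⟩
    refine ⟨⟨h, fun u m hm i j hi hj => ?_⟩, ?_⟩
    · by_cases hu : u = t
      · subst hu; exact h' u m (by simp [TriState.occupied]) i j hi hj
      · exact h' u m (by simpa [hu] using hm) i j hi hj
    · exact h' t (k + 2) (by simp [TriState.occupied]) _ _ (by simp) (by simp)
  · rintro ⟨⟨h, h'⟩, hs⟩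
    refine ⟨h, fun u m hm i j hi hj => ?_⟩
    by_cases hu : u = t
    · subst hu
      have h1 : s (site L u (k + 1)) (site L u (k + 2)) :=
        h' u k (by simp [TriState.occupied]) _ _ (by simp) (by simp)
      have key : ∀ i, s (site L u i) (site L u (k + 1)) := by
        intro i
        by_cases hik : i = k
        · rw [hik]; exact hs
        · rcases fin_three_eq_of_ne hik with rfl | rfl
          · exact s.refl _
          · exact s.symm h1
      exact s.trans (key i) (s.symm (key j))
    · exact h' u m (by simpa [hu] using hm) i j hi hj

open Classical in
theorem numClusters_update_E {L : TriLattice} {Λ : Finset (ℤ × ℤ)} (Γ : Setoid (Site L Λ))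
    (ω : Config Λ) (t : Λ) (k : Fin 3) :
    numClusters L Γ (Function.update ω t .E) = numClusters L Γ (Function.update ω t (.S k)) +
      if clusters L Γ (Function.update ω t .E) (site L t (k + 1)) (site L t (k + 2))
        then 0 else 1 := by
  rw [numClusters, numClusters, clusters_update_S]
  exact Setoid.card_quotient_merge _ _ _

-- The condition refers to connections with `t` empty, as in `numClusters_update_E`, so that every
-- change is expressed by what happens off `t`.
open Classical in
theorem numClusters_update_S {L : TriLattice} {Λ : Finset (ℤ × ℤ)} (Γ : Setoid (Site L Λ))
    (ω : Config Λ) (t : Λ) (k : Fin 3) :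
    numClusters L Γ (Function.update ω t (.S k)) = numClusters L Γ (Function.update ω t .A) +
      if clusters L Γ (Function.update ω t .E) (site L t k) (site L t (k + 1)) ∨
        clusters L Γ (Function.update ω t .E) (site L t k) (site L t (k + 2))
        then 0 else 1 := by
  rw [numClusters, numClusters, clusters_update_A Γ ω t k]
  refine (Setoid.card_quotient_merge _ (site L t k) (site L t (k + 1))).trans ?_
  congr 2
  rw [clusters_update_S, Setoid.merge_apply]
  have := (clusters L Γ (Function.update ω t .E)).refl (site L t (k + 1))
  simp only [this, true_or, and_true, eq_iff_iff]
  tauto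

theorem fin_three_add_add (m : Fin 3) :
    m + 1 + 1 = m + 2 ∧ m + 1 + 2 = m ∧ m + 2 + 1 = m ∧ m + 2 + 2 = m + 1 := by
  revert m; decide

/-! ### Planar duality at one triangle, by `ZMod 2` homology. -/

/-- The `ZMod 2`-valued cochain of the bonds on the half-line that leaves the site `x` in the
direction of the first basis vector. -/
def ray (L : TriLattice) (x t : ℤ × ℤ) (k : Fin 3) : ZMod 2 :=
  if k = 2 ∧ t.2 = x.2 ∧ 0 ≤ L.sign * (t.1 - x.1) then 1 else 0

/-- The bond `k` of `t`, closed up by the half-lines from its end points, bounds a set of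
triangles and faces. -/
theorem exists_potential_bond (L : TriLattice) (t₀ : ℤ × ℤ) (k₀ : Fin 3) :
    ∃ f g : ℤ × ℤ → ZMod 2, ∀ t k, g t + f (corner L.flip t k) =
      ray L (corner L t₀ (k₀ + 1)) t k + ray L (corner L t₀ (k₀ + 2)) t k +
        if t = t₀ ∧ k = k₀ then 1 else 0 := by
  obtain ⟨a, b⟩ := t₀
  -- A side 2 is the difference of the two half-lines, so no cells are needed. Otherwise the cells
  -- are those of the strip between the two half-lines. The triangle `t₀` itself lies in it for side
  -- 1 but not for side 0.
  refine ⟨fun d => if k₀ ≠ 2 ∧ d.2 = b ∧ 0 ≤ L.sign * (d.1 - a) then 1 else 0,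
    fun d => if k₀ ≠ 2 ∧ d.2 = b ∧ (if k₀ = 0 then 1 else 0) ≤ L.sign * (d.1 - a) then 1 else 0,
    ?_⟩
  rintro ⟨x, y⟩ k
  cases L <;> fin_cases k₀ <;> fin_cases k <;>
    simp [corner, offset, ray, TriLattice.flip, TriLattice.sign] <;>
    split_ifs <;> first | rfl | decide | (exfalso; omega)

theorem zmod_two_eq_of_add_eq_zero {a b : ZMod 2} (h : a + b = 0) : a = b := by
  revert a b; decide

/-- If the end points of the side `k` of an empty triangle `t` are connected, then the face across
that side is not connected, off `t`, to the other two faces at `t`. -/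
theorem not_clusters_flip_of_clusters (L : TriLattice) {Λ : Finset (ℤ × ℤ)} (ω : Config Λ) (t : Λ)
    (k j : Fin 3) (hj : j ≠ k)
    (h : clusters L (free L Λ) (Function.update ω t .E) (site L t (k + 1)) (site L t (k + 2))) :
    ¬ clusters L.flip (wired L.flip Λ) (Function.update (dualConfig ω) t .E)
      (site L.flip t k) (site L.flip t j) := by
  set ω₀ := Function.update ω t .E with hω₀
  let vacant (s : ℤ × ℤ) (m : Fin 3) : Prop := ∀ hs : s ∈ Λ, m ∉ (ω₀ ⟨s, hs⟩).occupied
  -- Sites are related if the sum of their half-lines is a coboundary on the vacant bonds, with `g`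
  -- on triangles and `f` on faces. Occupied bonds preserve this, since the bond term in
  -- `exists_potential_bond` sits on a bond that is not vacant.
  let Q : Setoid (Site L Λ) :=
    { r := fun x y => ∃ f g : ℤ × ℤ → ZMod 2, ∀ s m, vacant s m →
        g s + f (corner L.flip s m) = ray L x s m + ray L y s m
      iseqv := by
        refine ⟨fun x => ⟨0, 0, fun s m _ => ?_⟩, ?_, ?_⟩
        · simp [CharTwo.add_self_eq_zero]
        · rintro x y ⟨f, g, hfg⟩
          exact ⟨f, g, fun s m hv => (hfg s m hv).trans (add_comm _ _)⟩
        · rintro x y z ⟨f, g, hfg⟩ ⟨f', g', hfg'⟩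
          refine ⟨f + f', g + g', fun s m hv => ?_⟩
          have h1 := hfg s m hv
          have h2 := hfg' s m hv
          simp only [Pi.add_apply]
          rw [add_add_add_comm, h1, h2, add_assoc, ← add_assoc (ray L y s m),
            CharTwo.add_self_eq_zero, zero_add] }
  have hQ : clusters L (free L Λ) ω₀ ≤ Q := by
    refine clusters_le_iff.2 ⟨bot_le, fun s m hm i i' hi hi' => ?_⟩
    have key : Q (site L s (m + 1)) (site L s (m + 2)) := by
      obtain ⟨f, g, hfg⟩ := exists_potential_bond L s m
      refine ⟨f, g, fun s' m' hv => ?_⟩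
      rw [hfg s' m', if_neg, add_zero]
      · rfl
      · rintro ⟨rfl, rfl⟩
        exact hv s.2 hm
    rcases fin_three_eq_of_ne hi with rfl | rfl <;> rcases fin_three_eq_of_ne hi' with rfl | rfl
    · exact Q.refl _
    · exact key
    · exact Q.symm key
    · exact Q.refl _
  obtain ⟨f, g, hfg⟩ := hQ h
  obtain ⟨f', g', hfg'⟩ := exists_potential_bond L t k
  -- The half-lines cancel: the sum is the indicator of the inside of the circuit formed by the path
  -- and side `k` of `t`, and among vacant bonds it jumps only across that side.
  have hFG : ∀ s m, vacant s m → (g s + g' s) + (f (corner L.flip s m) + f' (corner L.flip s m)) =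
      if s = t ∧ m = k then 1 else 0 := by
    intro s m hv
    rw [add_add_add_comm, hfg s m hv, hfg' s m, ← add_assoc]
    change ray L (corner L t (k + 1)) s m + ray L (corner L t (k + 2)) s m + _ + _ = _
    rw [CharTwo.add_self_eq_zero, zero_add]
  have hFG' : ∀ s m, vacant s m → ¬ (s = t ∧ m = k) →
      g s + g' s = f (corner L.flip s m) + f' (corner L.flip s m) := fun s m hv hsm =>
    zmod_two_eq_of_add_eq_zero ((hFG s m hv).trans (if_neg hsm))
  have hF : clusters L.flip (wired L.flip Λ) (Function.update (dualConfig ω) t .E) ≤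
      Setoid.ker fun x : Site L.flip Λ => f x + f' x := by
    refine clusters_le_iff.2 ⟨?_, fun s m hm i i' hi hi' => ?_⟩
    · have hB : Relation.EqvGen.setoid (fun x y : ℤ × ℤ =>
          ∃ s ∉ Λ, ∃ i j, corner L.flip s i = x ∧ corner L.flip s j = y) ≤
            Setoid.ker fun x => f x + f' x := by
        refine Setoid.eqvGen_le ?_
        rintro _ _ ⟨s, hs, i, i', rfl, rfl⟩
        have hv : ∀ m, vacant s m := fun m hs' => absurd hs' hs
        have hst : s ≠ t := fun e => hs (e ▸ t.2)
        exact (hFG' s i (hv i) fun e => hst e.1).symm.trans (hFG' s i' (hv i') fun e => hst e.1)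
      exact fun x y hxy => hB hxy
    · have hst : s ≠ t := by
        rintro rfl
        simp [TriState.occupied] at hm
      rw [Function.update_of_ne hst, dualConfig_apply] at hm
      have hv : ∀ i, i ≠ m → vacant s i := fun i hi _ => by
        have := TriState.notMem_occupied_of_mem_dual _ m i hm hi
        rwa [hω₀, Function.update_of_ne hst]
      have hst' : (s : ℤ × ℤ) ≠ t := fun e => hst (Subtype.ext e)
      exact (hFG' s i (hv i hi) fun e => hst' e.1).symm.trans
        (hFG' s i' (hv i' hi') fun e => hst' e.1)
  intro hc
  have hv : ∀ m, vacant t m := fun m ht => by simp [hω₀, TriState.occupied]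
  have h1 := hFG t k (hv k)
  have h2 := hFG' t j (hv j) fun e => hj e.2
  have h3 : f (corner L.flip t k) + f' (corner L.flip t k) =
    f (corner L.flip t j) + f' (corner L.flip t j) := hF hc
  rw [h3, h2, CharTwo.add_self_eq_zero] at h1
  simp at h1

/-- The pairing of a function of the sites with a function of the dual sites, through the `j`-th
and the `m`-th corners of the triangles, is symmetric in `j` and `m`. -/
theorem finsum_corner_mul_corner (L : TriLattice) {R : Type*} [Semiring R] (φ ψ : ℤ × ℤ → R)
    (j m : Fin 3) :
    ∑ᶠ s, φ (corner L s j) * ψ (corner L.flip s m) =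
      ∑ᶠ s, φ (corner L s m) * ψ (corner L.flip s j) := by
  -- Dual corners have opposite offsets, so the translation from corner `j` to corner `m` also takes
  -- dual corner `m` to dual corner `j`.
  rw [← finsum_comp_equiv (Equiv.addRight (L.sign • (offset m - offset j)))]
  refine finsum_congr fun s => ?_
  congr 2 <;> cases L <;> simp [corner, TriLattice.flip, TriLattice.sign] <;> abel

open Classical in
/-- If the end points of the side `k` of an empty triangle `t` are not connected, then the face
across that side is connected, off `t`, to one of the other two faces at `t`. -/
theorem clusters_flip_of_not_clusters (L : TriLattice) {Λ : Finset (ℤ × ℤ)} (ω : Config Λ) (t : Λ)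
    (k : Fin 3)
    (h : ¬ clusters L (free L Λ) (Function.update ω t .E) (site L t (k + 1)) (site L t (k + 2))) :
    ∃ j, j ≠ k ∧ clusters L.flip (wired L.flip Λ) (Function.update (dualConfig ω) t .E)
      (site L.flip t k) (site L.flip t j) := by
  by_contra! hD
  set ω₀ := Function.update ω t .E with hω₀
  set C := clusters L (free L Λ) ω₀
  set D := clusters L.flip (wired L.flip Λ) (Function.update (dualConfig ω) t .E) with hDdef
  let B : Setoid (ℤ × ℤ) := Relation.EqvGen.setoid fun x y =>
    ∃ s ∉ Λ, ∃ i j, corner L.flip s i = x ∧ corner L.flip s j = y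
  -- Indicators of the cluster of one end point of side `k` and of the dual cluster of the face
  -- across it. Under free conditions `φ` extends by 0. Under wired conditions `ψ` extends to be
  -- constant on every triangle outside `Λ`.
  let φ (v : ℤ × ℤ) : ZMod 2 := if ∃ x : Site L Λ, x = v ∧ C (site L t (k + 1)) x then 1 else 0
  let ψ (d : ℤ × ℤ) : ZMod 2 := if ∃ x : Site L.flip Λ, B x d ∧ D (site L.flip t k) x then 1 else 0
  have hφ : ∀ x : Site L Λ, φ x = if C (site L t (k + 1)) x then 1 else 0 := by
    intro x
    refine if_congr ⟨?_, fun hx => ⟨x, rfl, hx⟩⟩ rfl rfl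
    rintro ⟨y, hy, hC⟩
    rwa [← Subtype.ext hy]
  have hψ : ∀ x : Site L.flip Λ, ψ x = if D (site L.flip t k) x then 1 else 0 := by
    intro x
    refine if_congr ⟨?_, fun hx => ⟨x, B.refl _, hx⟩⟩ rfl rfl
    rintro ⟨y, hy, hDy⟩
    exact D.trans hDy (clusters_of_wiring hy)
  have hφC : ∀ x y, C x y → φ x = φ y := by
    intro x y hxy
    rw [hφ, hφ]
    exact if_congr ⟨fun hx => C.trans hx hxy, fun hy => C.trans hy (C.symm hxy)⟩ rfl rfl
  have hψD : ∀ x y, D x y → ψ x = ψ y := by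
    intro x y hxy
    rw [hψ, hψ]
    exact if_congr ⟨fun hx => D.trans hx hxy, fun hy => D.trans hy (D.symm hxy)⟩ rfl rfl
  have hψB : ∀ x y, B x y → ψ x = ψ y := by
    intro x y hxy
    refine if_congr ⟨?_, ?_⟩ rfl rfl
    · rintro ⟨z, hz, hDz⟩
      exact ⟨z, B.trans hz hxy, hDz⟩
    · rintro ⟨z, hz, hDz⟩
      exact ⟨z, B.trans hz (B.symm hxy), hDz⟩
  -- Only `φ` gives finite support; `ψ` can be 1 on infinitely many outside faces.
  have hsupp : ∀ j m : Fin 3,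
      (Function.support fun s => φ (corner L s j) * ψ (corner L.flip s m)).Finite := by
    intro j m
    refine ((finite_site L Λ).preimage
      (f := fun s => corner L s j) (Function.Injective.injOn ?_)).subset ?_
    · intro s s' hss
      cases L <;> simpa [corner] using hss
    · intro s hs
      have h0 : φ (corner L s j) ≠ 0 := left_ne_zero_of_mul hs
      have : ∃ x : Site L Λ, x = corner L s j ∧ C (site L t (k + 1)) x := by
        by_contra hx
        exact h0 (if_neg hx)
      obtain ⟨x, hx, -⟩ := this
      exact (congrArg (fun v => ∃ t ∈ Λ, ∃ k, corner L t k = v) hx).mp x.2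
  let T (j m : Fin 3) : ZMod 2 := ∑ᶠ s, φ (corner L s j) * ψ (corner L.flip s m)
  let τ (s : ℤ × ℤ) (m : Fin 3) : ZMod 2 :=
    φ (corner L s (m + 1)) * ψ (corner L.flip s m) + φ (corner L s (m + 2)) * ψ (corner L.flip s m)
  have hT : ∑ᶠ s, ∑ m, τ s m = ∑ m, (T (m + 1) m + T (m + 2) m) := by
    rw [finsum_sum_comm]
    · exact Finset.sum_congr rfl fun m _ => finsum_add_distrib (hsupp _ _) (hsupp _ _)
    · exact fun m _ => ((hsupp (m + 1) m).union (hsupp (m + 2) m)).subset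
        (Function.support_add _ _)
  -- The coboundary of `φ` sums to 0 around each face. Here this is the symmetry of `T`, by which
  -- every term occurs twice.
  have hT0 : ∑ m, (T (m + 1) m + T (m + 2) m) = 0 := by
    have hsymm : ∀ j m, T j m = T m j := finsum_corner_mul_corner L φ ψ
    have e1 := hsymm 1 0
    have e2 := hsymm 2 0
    have e3 := hsymm 2 1
    rw [Fin.sum_univ_three]
    change T 1 0 + T 2 0 + (T 2 1 + T 0 1) + (T 0 2 + T 1 2) = 0
    rw [e1, e2, e3]
    generalize T 0 1 = a
    generalize T 0 2 = b
    generalize T 1 2 = c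
    revert a b c; decide
  have hfull : ∀ a b c d : ZMod 2, (b * d + c * d) + (c * d + a * d) + (a * d + b * d) = 0 := by
    decide
  -- On a full triangle `φ` is constant. On an empty or outside one `ψ` is constant, and the
  -- coboundary of `φ` sums to 0 around the triangle. With one side occupied, `φ` does not change
  -- along it and `ψ` agrees on the faces across the other two.
  have hother : ∀ s, s ≠ (t : ℤ × ℤ) → ∑ m, τ s m = 0 := by
    intro s hst
    have hsame : (∀ i i', ψ (corner L.flip s i) = ψ (corner L.flip s i')) → ∑ m, τ s m = 0 := by
      intro hs
      rw [Fin.sum_univ_three]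
      simp only [τ]
      rw [hs 1 0, hs 2 0]
      exact hfull _ _ _ _
    by_cases hs : s ∈ Λ
    · have hst' : (⟨s, hs⟩ : Λ) ≠ t := fun e => hst (congrArg Subtype.val e)
      have hC : ∀ m ∈ (ω ⟨s, hs⟩).occupied, ∀ i j, i ≠ m → j ≠ m →
          φ (corner L s i) = φ (corner L s j) := fun m hm i j hi hj =>
        hφC (site L ⟨s, hs⟩ i) (site L ⟨s, hs⟩ j) (clusters_of_mem_occupied
          (by rwa [hω₀, Function.update_of_ne hst']) hi hj)
      have hDD : ∀ m ∈ (ω ⟨s, hs⟩).dual.occupied, ∀ i j, i ≠ m → j ≠ m →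
          ψ (corner L.flip s i) = ψ (corner L.flip s j) := fun m hm i j hi hj =>
        hψD (site L.flip ⟨s, hs⟩ i) (site L.flip ⟨s, hs⟩ j) (clusters_of_mem_occupied
          (by rwa [Function.update_of_ne hst', dualConfig_apply]) hi hj)
      cases hX : ω ⟨s, hs⟩ with
      | E =>
        rw [hX] at hDD
        refine hsame fun i i' => ?_
        have : ∀ i i' : Fin 3, ∃ m, i ≠ m ∧ i' ≠ m := by decide
        obtain ⟨m, hi, hi'⟩ := this i i'
        exact hDD m (by simp [TriState.dual, TriState.occupied]) i i' hi hi'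
      | S m =>
        rw [hX] at hDD hC
        have h1 := hC m (by simp [TriState.occupied]) (m + 1) (m + 2) (by simp) (by simp)
        have h2 := hDD m (by simp [TriState.dual, TriState.occupied])
          (m + 1) (m + 2) (by simp) (by simp)
        have hsum : ∑ m', τ s m' = τ s m + τ s (m + 1) + τ s (m + 2) := by
          rw [Fin.sum_univ_three]
          fin_cases m
          · rfl
          · change _ = τ s 1 + τ s 2 + τ s 0
            ring
          · change _ = τ s 2 + τ s 0 + τ s 1
            ring
        rw [hsum]
        obtain ⟨e1, e2, e3, e4⟩ := fin_three_add_add m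
        simp only [τ, e1, e2, e3, e4]
        rw [h1, h2]
        generalize φ _ = a
        generalize φ _ = b
        generalize ψ _ = c
        generalize ψ _ = d
        revert a b c d; decide
      | A =>
        rw [hX] at hC
        have : ∀ i i' : Fin 3, ∃ m, i ≠ m ∧ i' ≠ m := by decide
        refine Finset.sum_eq_zero fun m _ => ?_
        obtain ⟨n, hi, hi'⟩ := this (m + 1) (m + 2)
        simp only [τ]
        rw [hC n (by simp [TriState.occupied]) _ _ hi hi', CharTwo.add_self_eq_zero]
    · exact hsame fun i i' => hψB _ _ (Relation.EqvGen.rel _ _ ⟨s, hs, i, i', rfl, rfl⟩)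
  have htri : ∑ m, τ t m = 1 := by
    rw [Finset.sum_eq_single k]
    · have h1 : φ (corner L t (k + 1)) = 1 := (hφ (site L t (k + 1))).trans (if_pos (C.refl _))
      have h2 : φ (corner L t (k + 2)) = 0 := (hφ (site L t (k + 2))).trans (if_neg h)
      have h3 : ψ (corner L.flip t k) = 1 := (hψ (site L.flip t k)).trans (if_pos (D.refl _))
      simp only [τ]
      rw [h1, h2, h3]
      simp
    · intro m _ hm
      have h3 : ψ (corner L.flip t m) = 0 := (hψ (site L.flip t m)).trans (if_neg (hD m hm))
      simp only [τ]
      rw [h3]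
      simp
    · simp
  rw [hT0, finsum_eq_single _ (t : ℤ × ℤ) hother, htri] at hT
  exact one_ne_zero hT

/-! ### Euler's formula. -/

/-- The exponent of `q` that a triangle contributes to the duality relation: the number of closed
sides of the triangle in excess of the number needed to connect its dual corners, that is `2` for
an empty triangle, `1` for a singly occupied one and `0` for a full one. -/
def TriState.deficit : TriState → ℕ
  | .E => 2
  | .S _ => 1
  | .A => 0

theorem TriState.deficit_dual_add (X : TriState) : X.dual.deficit + X.deficit = 2 := by
  cases X <;> rfl

theorem numClusters_update_duality (L : TriLattice) {Λ : Finset (ℤ × ℤ)} (ω : Config Λ) (t : Λ)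
    (X : TriState) :
    numClusters L (free L Λ) (Function.update ω t X) +
        numClusters L.flip (wired L.flip Λ) (Function.update (dualConfig ω) t .A) + 2 =
      numClusters L.flip (wired L.flip Λ) (Function.update (dualConfig ω) t X.dual) + X.deficit +
        numClusters L (free L Λ) (Function.update ω t .E) := by
  classical
  set C := clusters L (free L Λ) (Function.update ω t .E) with hC
  set D := clusters L.flip (wired L.flip Λ) (Function.update (dualConfig ω) t .E) with hD
  have hdual : ∀ k, C (site L t (k + 1)) (site L t (k + 2)) ↔
      ¬ (D (site L.flip t k) (site L.flip t (k + 1)) ∨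
        D (site L.flip t k) (site L.flip t (k + 2))) := by
    intro k
    constructor
    · rintro h (h' | h')
      · exact not_clusters_flip_of_clusters L ω t k (k + 1) (by simp) h h'
      · exact not_clusters_flip_of_clusters L ω t k (k + 2) (by simp) h h'
    · intro h
      by_contra h'
      obtain ⟨j, hj, hjD⟩ := clusters_flip_of_not_clusters L ω t k h'
      rcases fin_three_eq_of_ne hj with rfl | rfl
      · exact h (Or.inl hjD)
      · exact h (Or.inr hjD)
  -- By `hdual`, exactly one of two steps loses a cluster: empty to `S k`, or dual `S k` to dual
  -- full.
  have hS : ∀ k, numClusters L (free L Λ) (Function.update ω t (.S k)) +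
      numClusters L.flip (wired L.flip Λ) (Function.update (dualConfig ω) t .A) + 1 =
      numClusters L.flip (wired L.flip Λ) (Function.update (dualConfig ω) t (.S k)) +
        numClusters L (free L Λ) (Function.update ω t .E) := by
    intro k
    have h1 := numClusters_update_E (free L Λ) ω t k
    have h2 := numClusters_update_S (wired L.flip Λ) (dualConfig ω) t k
    rw [← hC] at h1
    rw [← hD] at h2
    have h3 := hdual k
    split_ifs at h1 h2 <;> first | omega | (exfalso; tauto)
  cases X with
  | E =>
    simp only [TriState.dual, TriState.deficit]
    omega
  | S k =>
    have := hS k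
    simp only [TriState.dual, TriState.deficit]
    omega
  | A =>
    have h0 := hS 0
    have h1 := numClusters_update_S (free L Λ) ω t 0
    have h2 := numClusters_update_E (wired L.flip Λ) (dualConfig ω) t 0
    rw [← hC] at h1
    rw [← hD] at h2
    -- This is the alternative with the roles of the lattices exchanged. It needs no new topology:
    -- it follows from `hdual` at corners 1 and 2 and transitivity of `D`.
    have hx : D (site L.flip t (0 + 1)) (site L.flip t (0 + 2)) ↔
        ¬ (C (site L t 0) (site L t (0 + 1)) ∨ C (site L t 0) (site L t (0 + 2))) := by
      have d1 : C (site L t 2) (site L t 0) ↔ ¬ (D (site L.flip t 1) (site L.flip t 2) ∨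
        D (site L.flip t 1) (site L.flip t 0)) := hdual 1
      have d2 : C (site L t 0) (site L t 1) ↔ ¬ (D (site L.flip t 2) (site L.flip t 0) ∨
        D (site L.flip t 2) (site L.flip t 1)) := hdual 2
      change D (site L.flip t 1) (site L.flip t 2) ↔
        ¬ (C (site L t 0) (site L t 1) ∨ C (site L t 0) (site L t 2))
      rw [Setoid.comm' C (x := site L t 0) (y := site L t 2), d1, d2,
        Setoid.comm' D (x := site L.flip t 2) (y := site L.flip t 1)]
      have htrans : D (site L.flip t 1) (site L.flip t 0) → D (site L.flip t 2) (site L.flip t 0) →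
        D (site L.flip t 1) (site L.flip t 2) := fun h h' => D.trans h (D.symm h')
      tauto
    simp only [TriState.dual, TriState.deficit]
    split_ifs at h1 h2 <;> first | omega | (exfalso; tauto)

theorem Fintype.eq_of_forall_update_eq {ι β γ : Type*} [Fintype ι] [DecidableEq ι]
    (f : (ι → β) → γ) (h : ∀ x i b, f (Function.update x i b) = f x) (x y : ι → β) : f x = f y := by
  have key : ∀ s : Finset ι, f (s.piecewise x y) = f y := by
    intro s
    induction s using Finset.induction_on with
    | empty => rw [Finset.piecewise_empty]
    | insert i s _ ih => rw [Finset.piecewise_insert, h, ih]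
  rw [← key Finset.univ, Finset.piecewise_univ]

/-- Euler's formula for a configuration and its dual. -/
theorem exists_numClusters_free_add (L : TriLattice) (Λ : Finset (ℤ × ℤ)) :
    ∃ m n : ℕ, ∀ ω : Config Λ, numClusters L (free L Λ) ω + m =
      numClusters L.flip (wired L.flip Λ) (dualConfig ω) + ∑ t, (ω t).deficit + n := by
  let Φ (ω : Config Λ) : ℤ := numClusters L (free L Λ) ω -
    numClusters L.flip (wired L.flip Λ) (dualConfig ω) - (∑ t, (ω t).deficit : ℕ)
  have hsum : ∀ (ω : Config Λ) (t : Λ) X, ∑ s, (Function.update ω t X s).deficit =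
      X.deficit + ∑ s ∈ Finset.univ.erase t, (ω s).deficit := by
    intro ω t X
    rw [← Finset.add_sum_erase _ _ (Finset.mem_univ t), Function.update_self]
    congr 1
    refine Finset.sum_congr rfl fun s hs => ?_
    rw [Function.update_of_ne (Finset.ne_of_mem_erase hs)]
  have hE : ∀ (ω : Config Λ) (t : Λ) X,
      Φ (Function.update ω t X) = Φ (Function.update ω t .E) := by
    intro ω t X
    have h1 := numClusters_update_duality L ω t X
    simp only [Φ, hsum, dualConfig_update]
    simp only [TriState.dual, TriState.deficit] at h1 ⊢
    push_cast
    omega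
  have hΦ : ∀ ω, Φ ω = Φ fun _ => .A := fun ω =>
    Fintype.eq_of_forall_update_eq Φ (fun x t X => by
      rw [hE, ← hE x t (x t), Function.update_eq_self]) _ _
  -- The constant is read off at the full configuration, of deficit 0, and split over both sides to
  -- stay in `ℕ`.
  refine ⟨numClusters L.flip (wired L.flip Λ) (dualConfig fun _ => .A),
    numClusters L (free L Λ) fun _ => .A, fun ω => ?_⟩
  have := hΦ ω
  have hA : ∑ _t : Λ, TriState.A.deficit = 0 := Finset.sum_const_zero
  simp only [Φ, hA] at this
  omega

/-- Apply the free case to the dual configuration: duality is an involution, and the deficits of a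
triangle and its dual add up to 2. -/
theorem exists_numClusters_wired_add (L : TriLattice) (Λ : Finset (ℤ × ℤ)) :
    ∃ m n : ℕ, ∀ ω : Config Λ, numClusters L.flip (wired L.flip Λ) ω + m =
      numClusters L (free L Λ) (dualConfig ω) + ∑ t, (ω t).deficit + n := by
  obtain ⟨m, n, h⟩ := exists_numClusters_free_add L Λ
  refine ⟨n + ∑ _t : Λ, 2, m, fun ω => ?_⟩
  have h1 := h (dualConfig ω)
  rw [dualConfig_dualConfig] at h1
  have h2 : ∑ t, (dualConfig ω t).deficit + ∑ t, (ω t).deficit = ∑ _t : Λ, 2 := by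
    rw [← Finset.sum_add_distrib]
    exact Finset.sum_congr rfl fun t _ => by rw [dualConfig_apply, TriState.deficit_dual_add]
  omega

theorem bijective_dualConfig (Λ : Finset (ℤ × ℤ)) :
    Function.Bijective (dualConfig : Config Λ → Config Λ) :=
  Function.Involutive.bijective dualConfig_dualConfig

/-! ### Duality of the random cluster measures. -/

theorem Weights.of_nonneg (w : Weights) (X : TriState) : 0 ≤ w.of X := by
  cases X
  exacts [w.e_nonneg, w.s_nonneg, w.a_nonneg]

theorem Weights.of_dual {q : ℝ} {w w' : Weights} (h : DualityRelations q w w')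
    (X : TriState) (ha : 0 < w.a) :
    w'.of X.dual = w'.e / w.a * (q ^ X.deficit * w.of X) := by
  obtain ⟨he, hs, ha'⟩ := h
  rw [div_eq_iff he.ne'] at hs ha'
  cases X
  · simp only [TriState.dual, Weights.of, TriState.deficit]
    rw [ha']; ring
  · simp only [TriState.dual, Weights.of, TriState.deficit]
    rw [hs]; ring
  · simp only [TriState.dual, Weights.of, TriState.deficit]
    field_simp

theorem rcWeight_nonneg {q : ℝ} (hq : 0 < q) (w : Weights) {L : TriLattice} {Λ : Finset (ℤ × ℤ)}
    (Γ : Setoid (Site L Λ)) (ω : Config Λ) : 0 ≤ rcWeight q w L Γ ω :=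
  mul_nonneg (pow_nonneg hq.le _) (Finset.prod_nonneg fun _ _ => w.of_nonneg _)

theorem rcWeight_pos {q : ℝ} (hq : 0 < q) {w : Weights} {L : TriLattice} {Λ : Finset (ℤ × ℤ)}
    (Γ : Setoid (Site L Λ)) {X : TriState} (hX : 0 < w.of X) : 0 < rcWeight q w L Γ fun _ => X :=
  mul_pos (pow_pos hq _) (Finset.prod_pos fun _ _ => hX)

theorem sum_rcWeight_pos {q : ℝ} (hq : 0 < q) {w : Weights} {L : TriLattice} {Λ : Finset (ℤ × ℤ)}
    (Γ : Setoid (Site L Λ)) {X : TriState} (hX : 0 < w.of X) : 0 < ∑ ω, rcWeight q w L Γ ω :=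
  Finset.sum_pos' (fun _ _ => rcWeight_nonneg hq w Γ _)
    ⟨fun _ => X, Finset.mem_univ _, rcWeight_pos hq Γ hX⟩

section Duality

variable {q : ℝ} {w w' : Weights} {L L' : TriLattice} {Λ : Finset (ℤ × ℤ)} {Γ : Setoid (Site L Λ)}
  {Γ' : Setoid (Site L' Λ)} {m n : ℕ}

theorem rcProb_dualConfig (hq : 0 < q) (ha : 0 < w.a)
    (h : ∀ ω : Config Λ, numClusters L Γ ω + m =
      numClusters L' Γ' (dualConfig ω) + ∑ t, (ω t).deficit + n)
    (hw : DualityRelations q w w') (ω : Config Λ) :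
    rcProb q w' L' Γ' (dualConfig ω) = rcProb q w L Γ ω := by
  set K : ℝ := q ^ m * (w'.e / w.a) ^ Fintype.card Λ / q ^ n with hK
  have hKpos : 0 < K :=
    div_pos (mul_pos (pow_pos hq _) (pow_pos (div_pos hw.1 ha) _)) (pow_pos hq _)
  have hweight : ∀ ω, rcWeight q w' L' Γ' (dualConfig ω) = K * rcWeight q w L Γ ω := by
    intro ω
    have hprod : ∏ t, w'.of (dualConfig ω t) =
        (w'.e / w.a) ^ Fintype.card Λ * (q ^ (∑ t, (ω t).deficit) * ∏ t, w.of (ω t)) := by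
      rw [← Finset.prod_pow_eq_pow_sum, ← Finset.prod_mul_distrib, ← Finset.card_univ,
        ← Finset.prod_const, ← Finset.prod_mul_distrib]
      exact Finset.prod_congr rfl fun t _ => by rw [dualConfig_apply, Weights.of_dual hw _ ha]
    have hpow := congrArg (fun i => q ^ i) (h ω)
    simp only [pow_add] at hpow
    rw [rcWeight, rcWeight, hprod, hK, div_mul_eq_mul_div, eq_div_iff (pow_pos hq n).ne']
    linear_combination (-(w'.e / w.a) ^ Fintype.card Λ * ∏ t, w.of (ω t)) * hpow
  have hZ : ∑ ω, rcWeight q w' L' Γ' ω = K * ∑ ω, rcWeight q w L Γ ω := by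
    rw [Finset.mul_sum, ← (bijective_dualConfig Λ).sum_comp]
    exact Finset.sum_congr rfl fun ω _ => hweight ω
  rw [rcProb, rcProb, hweight, hZ, mul_div_mul_left _ _ hKpos.ne']

theorem dualityRelations_of_rcProb (hq : 0 < q) (ha : 0 < w.a) (hΛ : Λ.Nonempty)
    (h : ∀ ω : Config Λ, numClusters L Γ ω + m =
      numClusters L' Γ' (dualConfig ω) + ∑ t, (ω t).deficit + n)
    (hprob : ∀ ω : Config Λ, rcProb q w' L' Γ' (dualConfig ω) = rcProb q w L Γ ω) :
    DualityRelations q w w' := by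
  obtain ⟨t₀, ht₀⟩ := hΛ
  let t : Λ := ⟨t₀, ht₀⟩
  -- The full configuration has positive probability, and its dual is empty.
  have he : 0 < w'.e := by
    refine w'.e_nonneg.lt_of_ne fun h0 => ?_
    have hpos : 0 < rcProb q w L Γ fun _ => .A :=
      div_pos (rcWeight_pos hq Γ (X := .A) ha) (sum_rcWeight_pos hq Γ (X := .A) ha)
    rw [← hprob, rcProb, rcWeight, Finset.prod_eq_zero (Finset.mem_univ t)] at hpos
    · simp at hpos
    · rw [dualConfig_apply]
      exact h0.symm
  -- The solution of the relations scaled to share `w'.e`. Its measure equals that of `w'`, and so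
  -- does its weight of the empty configuration, hence its partition function too.
  let v : Weights := ⟨w'.e, q * w.s / w.a * w'.e, q ^ 2 * w.e / w.a * w'.e, he.le,
    mul_nonneg (div_nonneg (mul_nonneg hq.le w.s_nonneg) ha.le) he.le,
    mul_nonneg (div_nonneg (mul_nonneg (sq_nonneg q) w.e_nonneg) ha.le) he.le⟩
  have hv : DualityRelations q w v :=
    ⟨he, mul_div_cancel_right₀ _ he.ne', mul_div_cancel_right₀ _ he.ne'⟩
  have hZ' := sum_rcWeight_pos (w := w') hq Γ' (X := .E) he
  have hZ := sum_rcWeight_pos (w := v) hq Γ' (X := .E) he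
  have hprob' : ∀ η, rcProb q w' L' Γ' η = rcProb q v L' Γ' η := by
    intro η
    rw [← dualConfig_dualConfig η, hprob, rcProb_dualConfig hq ha h hv]
  have hWE : rcWeight q w' L' Γ' (fun _ => .E) = rcWeight q v L' Γ' fun _ => .E := rfl
  have hZZ : ∑ η, rcWeight q w' L' Γ' η = ∑ η, rcWeight q v L' Γ' η := by
    have h1 := hprob' fun _ => .E
    rw [rcProb, rcProb, hWE] at h1
    rw [div_eq_div_iff hZ'.ne' hZ.ne'] at h1
    exact (mul_left_cancel₀ (rcWeight_pos (w := v) hq Γ' (X := .E) he).ne' h1).symm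
  have hW : ∀ X : TriState, w'.of X = v.of X := by
    intro X
    have h1 := hprob' (Function.update (fun _ => .E) t X)
    rw [rcProb, rcProb, hZZ, div_left_inj' hZ.ne', rcWeight, rcWeight,
      mul_right_inj' (pow_pos hq _).ne'] at h1
    have hprod : ∀ u : Weights, ∏ s, u.of (Function.update (fun _ : Λ => TriState.E) t X s) =
        u.of X * ∏ s ∈ Finset.univ.erase t, u.e := by
      intro u
      rw [← Finset.mul_prod_erase _ _ (Finset.mem_univ t), Function.update_self]
      congr 1
      refine Finset.prod_congr rfl fun s hs => ?_
      rw [Function.update_of_ne (Finset.ne_of_mem_erase hs)]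
      rfl
    rw [hprod, hprod] at h1
    exact mul_right_cancel₀ (Finset.prod_pos fun _ _ => he).ne' h1
  have hs : w'.s = v.s := hW (.S 0)
  have ha' : w'.a = v.a := hW .A
  exact ⟨he, hs ▸ hv.2.1, ha' ▸ hv.2.2⟩

theorem forall_rcProb_dualConfig_iff (hq : 0 < q) (ha : 0 < w.a) (hΛ : Λ.Nonempty)
    (h : ∃ m n : ℕ, ∀ ω : Config Λ, numClusters L Γ ω + m =
      numClusters L' Γ' (dualConfig ω) + ∑ t, (ω t).deficit + n) :
    (∀ ω : Config Λ, rcProb q w' L' Γ' (dualConfig ω) = rcProb q w L Γ ω) ↔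
      DualityRelations q w w' := by
  obtain ⟨m, n, h⟩ := h
  exact ⟨dualityRelations_of_rcProb hq ha hΛ h, rcProb_dualConfig hq ha h⟩

end Duality

/-! ### The honeycomb dual and the shape of wired boundary conditions. -/

/-- Dual bonds are two-step paths through a centre. Conversely, each centre is retracted to a face
that it is joined to; the centre of a full triangle is isolated, so its image is arbitrary. -/
theorem clusters_dualConfig_iff {Λ : Finset (ℤ × ℤ)} (Γ : Setoid (Site .down Λ)) (ω : Config Λ)
    (x y : Site .down Λ) :
    clusters .down Γ (dualConfig ω) x y ↔
      honeycombClusters Γ (starDual ω) (.inr x) (.inr y) := by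
  constructor
  · have h : clusters .down Γ (dualConfig ω) ≤
        Setoid.comap Sum.inr (honeycombClusters Γ (starDual ω)) := by
      refine clusters_le_iff.2 ⟨fun x y hxy =>
        Relation.EqvGen.rel _ _ (Or.inl ⟨x, y, hxy, rfl, rfl⟩), fun t k hk i j hi hj => ?_⟩
      rw [dualConfig_apply] at hk
      have hmem : ∀ i, i ≠ k → honeycombClusters Γ (starDual ω) (.inl t) (.inr (site .down t i)) :=
        fun i hi => Relation.EqvGen.rel _ _ (Or.inr ⟨t, i, by
          simpa [starDual] using TriState.notMem_occupied_of_mem_dual _ k i hk hi,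
          site .down t i, rfl, rfl, rfl⟩)
      exact (honeycombClusters Γ (starDual ω)).trans
        ((honeycombClusters Γ (starDual ω)).symm (hmem i hi)) (hmem j hj)
    exact fun hxy => h hxy
  · let C := clusters .down Γ (dualConfig ω)
    -- a face that is joined to the centre of `t` if there is one
    let rep : Λ ⊕ Site .down Λ → Site .down Λ := Sum.elim (fun t =>
      match ω t with
      | .S k => site .down t (k + 1)
      | _ => site .down t 0) id
    have h : honeycombClusters Γ (starDual ω) ≤ Setoid.comap rep C := by
      refine Setoid.eqvGen_le ?_
      rintro _ _ (⟨x, y, hxy, rfl, rfl⟩ | ⟨t, k, hk, ⟨_, _⟩, rfl, rfl, rfl⟩)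
      · exact clusters_of_wiring (ω := dualConfig ω) hxy
      · have hD : ∀ m ∈ (ω t).dual.occupied, ∀ i j, i ≠ m → j ≠ m →
            C (site .down t i) (site .down t j) := fun m hm i j hi hj =>
          clusters_of_mem_occupied (by rwa [dualConfig_apply]) hi hj
        change k ∈ (ω t).occupiedᶜ at hk
        change C (match ω t with
          | .S k => site .down t (k + 1)
          | _ => site .down t 0) (site .down t k)
        cases hX : ω t with
        | E =>
          rw [hX] at hD
          have : ∀ i i' : Fin 3, ∃ m, i ≠ m ∧ i' ≠ m := by decide
          obtain ⟨m, hi, hi'⟩ := this 0 k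
          exact hD m (by simp [TriState.dual, TriState.occupied]) _ _ hi hi'
        | S m =>
          rw [hX] at hD hk
          exact hD m (by simp [TriState.dual, TriState.occupied]) _ _ (by simp)
            (by simpa [TriState.occupied] using hk)
        | A =>
          rw [hX] at hk
          simp [TriState.occupied] at hk
    exact fun hxy => h hxy

theorem wired_le_fullyWired (L : TriLattice) (Λ : Finset (ℤ × ℤ)) : wired L Λ ≤ fullyWired L Λ := by
  intro x y hxy
  have h : ∀ x y : ℤ × ℤ, Relation.EqvGen
      (fun x y => ∃ t ∉ Λ, ∃ i j, corner L t i = x ∧ corner L t j = y) x y →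
        x = y ∨ (IsBoundary L Λ x ∧ IsBoundary L Λ y) := by
    intro x y hxy
    induction hxy with
    | rel x y h =>
      obtain ⟨t, ht, i, j, hi, hj⟩ := h
      exact Or.inr ⟨⟨t, ht, i, hi⟩, t, ht, j, hj⟩
    | refl x => exact Or.inl rfl
    | symm x y _ ih => exact ih.imp Eq.symm And.symm
    | trans x y z _ _ ih ih' =>
      rcases ih with rfl | ih
      · exact ih'
      · rcases ih' with rfl | ih'
        · exact Or.inr ih
        · exact Or.inr ⟨ih.1, ih'.2⟩
  exact (h x y hxy).imp_left Subtype.ext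

/-- Up-pointing triangles that share a corner correspond to down-pointing ones that do. -/
theorem exists_corner_eq_corner (L : TriLattice) {u v : ℤ × ℤ}
    (h : ∃ i j, corner .up u i = corner .up v j) : ∃ i j, corner L u i = corner L v j := by
  obtain ⟨i, j, hij⟩ := h
  cases L with
  | up => exact ⟨i, j, hij⟩
  | down =>
    refine ⟨j, i, ?_⟩
    simp only [corner] at hij ⊢
    rw [sub_eq_sub_iff_add_eq_add, hij]

/-- Follow the chain of outside triangles: each connects its own corners and shares one with the
next, on either lattice by `exists_corner_eq_corner`. -/
theorem HoleFree.wired_eq_fullyWired {Λ : Finset (ℤ × ℤ)} (h : HoleFree Λ) (L : TriLattice) :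
    wired L Λ = fullyWired L Λ := by
  refine le_antisymm (wired_le_fullyWired L Λ) ?_
  rintro x y (rfl | ⟨⟨t, ht, k, hk⟩, ⟨t', ht', k', hk'⟩⟩)
  · exact Setoid.refl' _ _
  · let B : Setoid (ℤ × ℤ) := Relation.EqvGen.setoid fun x y =>
      ∃ t ∉ Λ, ∃ i j, corner L t i = x ∧ corner L t j = y
    have hB : ∀ s, s ∉ Λ → ∀ i j, B (corner L s i) (corner L s j) := fun s hs i j =>
      Relation.EqvGen.rel _ _ ⟨s, hs, i, j, rfl, rfl⟩
    have key : ∀ u, Relation.ReflTransGen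
        (fun u v => v ∉ Λ ∧ ∃ i j, corner .up u i = corner .up v j) t u →
          ∀ j, B (corner L t k) (corner L u j) := by
      intro u hu
      induction hu with
      | refl => exact hB t ht k
      | @tail u v _ huv ih =>
        intro j
        obtain ⟨i, i', hi⟩ := exists_corner_eq_corner L huv.2
        exact B.trans (ih i) (hi ▸ hB v huv.1 i' j)
    have := key t' (h t ht t' ht') k'
    rw [hk, hk'] at this
    exact this

/-! ### Dual weights, the self-dual curve and the main theorem. -/

/-- The relation for `a` reads a² = (q e)², whose positive root makes the relation for `s`
automatic. -/
theorem dualityRelations_self_iff {q : ℝ} (hq : 0 < q) {w : Weights} (ha : 0 < w.a) :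
    DualityRelations q w w ↔ w.a = q * w.e := by
  constructor
  · rintro ⟨he, -, h⟩
    rw [div_eq_div_iff he.ne' ha.ne'] at h
    refine (sq_eq_sq₀ ha.le (mul_pos hq he).le).1 ?_
    linear_combination h
  · intro h
    have he : 0 < w.e := pos_of_mul_pos_right (h ▸ ha) hq.le
    refine ⟨he, ?_, ?_⟩
    · rw [h]; field_simp
    · rw [h]; field_simp

/-- The relations fix the ratios to `e`, and the normalization then fixes `e`. -/
theorem DualityRelations.eq_of_normalized {q : ℝ} {w v v' : Weights}
    (hv : v.Normalized) (hv' : v'.Normalized) (h : DualityRelations q w v)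
    (h' : DualityRelations q w v') : v = v' := by
  obtain ⟨he, hs, ha⟩ := h
  obtain ⟨he', hs', ha'⟩ := h'
  rw [← hs', div_eq_iff he.ne'] at hs
  rw [← ha', div_eq_iff he.ne'] at ha
  simp only [Weights.Normalized] at hv hv'
  have key : v.e = v'.e := by
    have h1 : v.e * (v'.a / v'.e + 3 * (v'.s / v'.e) + 1) = 1 := by
      linear_combination hv - ha - 3 * hs
    have h2 : v'.e * (v'.a / v'.e + 3 * (v'.s / v'.e) + 1) = 1 := by
      rw [mul_add, mul_add, mul_left_comm, mul_div_cancel₀ _ he'.ne', mul_div_cancel₀ _ he'.ne']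
      linear_combination hv'
    exact mul_right_cancel₀ (right_ne_zero_of_mul (h1.trans_ne one_ne_zero)) (h1.trans h2.symm)
  rw [key, div_mul_cancel₀ _ he'.ne'] at hs ha
  exact Weights.ext key hs ha

theorem existsUnique_normalized_dual {q : ℝ} (hq : 0 < q) (w : Weights) (ha : 0 < w.a) :
    ∃! w' : Weights, w'.Normalized ∧ DualityRelations q w w' := by
  set σ := q * w.s / w.a with hσ
  set α := q ^ 2 * w.e / w.a with hα
  have hσ0 : 0 ≤ σ := div_nonneg (mul_nonneg hq.le w.s_nonneg) ha.le
  have hα0 : 0 ≤ α := div_nonneg (mul_nonneg (sq_nonneg q) w.e_nonneg) ha.le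
  have hZ : 0 < α + 3 * σ + 1 := by positivity
  refine ⟨⟨1 / (α + 3 * σ + 1), σ / (α + 3 * σ + 1), α / (α + 3 * σ + 1), by positivity,
    by positivity, by positivity⟩, ⟨?_, ?_, ?_, ?_⟩, ?_⟩
  · simp only [Weights.Normalized]; field_simp
  · positivity
  · simp only [← hσ]; field_simp
  · simp only [← hα]; field_simp
  · rintro v ⟨hv, hv'⟩
    refine DualityRelations.eq_of_normalized hv ?_ hv' ⟨?_, ?_, ?_⟩
    · simp only [Weights.Normalized]; field_simp
    · positivity
    · simp only [← hσ]; field_simp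
    · simp only [← hα]; field_simp

theorem mainTheorem4 (q : ℝ) (hq : 0 < q) (w : Weights) (ha : 0 < w.a) :
    -- the finite-volume duality
    (∀ Λ : Finset (ℤ × ℤ), Λ.Nonempty →
      -- `ω*` records the connectivity of the standard dual `ω★` on the honeycomb lattice
      Function.Bijective (dualConfig : Config Λ → Config Λ) ∧
      (∀ (Γ : Setoid (Site .down Λ)) (ω : Config Λ) (x y : Site .down Λ),
        clusters .down Γ (dualConfig ω) x y ↔
          honeycombClusters Γ (starDual ω) (.inr x) (.inr y)) ∧
      -- free boundary conditions are dual to wired ones, and conversely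
      (∀ w' : Weights,
        (∀ ω : Config Λ,
          rcProb q w' .down (wired .down Λ) (dualConfig ω) = rcProb q w .up (free .up Λ) ω) ↔
        DualityRelations q w w') ∧
      (∀ w' : Weights,
        (∀ ω : Config Λ,
          rcProb q w' .down (free .down Λ) (dualConfig ω) = rcProb q w .up (wired .up Λ) ω) ↔
        DualityRelations q w w') ∧
      -- for a region without holes, `wired` means that all boundary sites are wired together
      (HoleFree Λ → ∀ L : TriLattice, wired L Λ = fullyWired L Λ)) ∧
    -- the dual weights exist and are unique under the normalization
    (∃! w' : Weights, w'.Normalized ∧ DualityRelations q w w') ∧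
    -- the self-dual curve
    (DualityRelations q w w ↔ w.a = q * w.e) ∧
    (w.Normalized → ∀ w' : Weights, w'.Normalized → DualityRelations q w w' →
      (w' = w ↔ w.a = q * w.e)) := by
  refine ⟨fun Λ hΛ => ⟨bijective_dualConfig Λ, clusters_dualConfig_iff, fun w' => ?_, fun w' => ?_,
    fun h => h.wired_eq_fullyWired⟩, existsUnique_normalized_dual hq w ha,
    dualityRelations_self_iff hq ha, fun hw w' hw' h => ⟨?_, fun haq => ?_⟩⟩
  · exact forall_rcProb_dualConfig_iff hq ha hΛ (exists_numClusters_free_add .up Λ)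
  -- Here `.down` carries the free conditions and its flip `.up` the wired ones.
  · exact forall_rcProb_dualConfig_iff hq ha hΛ (exists_numClusters_wired_add .down Λ)
  · rintro rfl
    exact (dualityRelations_self_iff hq ha).1 h
  · exact DualityRelations.eq_of_normalized hw' hw h ((dualityRelations_self_iff hq ha).2 haq)
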